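/- Let $I=(i_1,\dots,i_k)$ be a sequence of positive integers with $i_1+\dots+i_k=n$, and let $S_n^I$ be the set of multiset permutations of type $I$, i.e. of surjective maps $\tau\colon\{1,\dots,n\}\to\{1,\dots,k\}$ with $|\tau^{-1}(j)|=i_j$ for all $j$. The (non-strict) Bruhat order on $S_n^I$ is defined by $$\tau\prec\upsilon\iff \#\{j\le p\mid \tau(j)\ge q\}\le\#\{j\le p\mid\upsilon(j)\ge q\}\quad\text{for all }1\le p\le n,\ 1\le q\le k.$$ Let ${\rm Fl}_I(\mathbb R)$ be the real partial flag space of chains of subspaces $E_\bullet=(0=E_0\subset E_1\subset\dots\subset E_k=\mathbb R^n)$ with $\dim E_l=i_1+\dots+i_l$, with its usual topology (the quotient topology of ${\rm SL}(n,\mathbb R)/P$, where $P$ is the stabilizer of the standard flag). Fix a basis $e_1,\dots,e_n$ of $\mathbb R^n$ and put $F_p=\langle e_1,\dots,e_p\rangle$. The Schubert cell of $\omega\in S_n^I$ is $$X_\omega=\{E_\bullet\in{\rm Fl}_I(\mathbb R)\mid \dim(E_q\cap F_p)=\#\{i\le p\mid\omega(i)\le q\}\text{ for all }1\le p\le n,\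 1\le q\le k\},$$ and its closure $\overline X_\omega$ is the Schubert variety of $\omega$. The cell $X_\psi$ is called adjacent to $X_\omega$ if $X_\psi\subset\overline X_\omega$. **Proposition.** For any $\psi,\omega\in S_n^I$ we have $\psi\prec\omega$ if and only if $X_\psi$ is adjacent to $X_\omega$. Moreover, $\psi\prec\omega$ already if (and only if) $X_\psi\cap\overline X_\omega\neq\varnothing$. If $\psi\prec\omega$, then $\overline X_\psi\subset\overline X_\omega$. -/

import Mathlib

open Module

/-- An `I`-permutation of a multiset, for a composition `I = (i₁, …, i_k)` of `n` (positive parts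
with sum `n`, `k = I.length`): a surjective map `{1, …, n} → {1, …, k}` taking the value `j`
exactly `i_j` times.  Indices are zero-based, in `Fin n` and `Fin k`. -/
structure MultisetPerm {n : ℕ} (I : Composition n) where
  toFun : Fin n → Fin I.length
  surjective : Function.Surjective toFun
  card_fiber : ∀ j : Fin I.length,
    (Finset.univ.filter fun l : Fin n => toFun l = j).card = I.blocksFun j

namespace MultisetPerm

variable {n : ℕ} {I : Composition n}

/-- `r_τ[p, q] = #{j ≤ p | τ(j) ≥ q}`. -/
def rankNumber (τ : MultisetPerm I) (p : Fin n) (q : Fin I.length) : ℕ :=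
  (Finset.univ.filter fun j : Fin n => j ≤ p ∧ q ≤ τ.toFun j).card

/-- The (non-strict) Bruhat order on multiset permutations:
`τ ≺ υ` iff `r_τ[p, q] ≤ r_υ[p, q]` for all `p`, `q`. -/
def BruhatLE (τ υ : MultisetPerm I) : Prop :=
  ∀ (p : Fin n) (q : Fin I.length), τ.rankNumber p q ≤ υ.rankNumber p q

end MultisetPerm

/-- The span of the first `p` vectors `e₁, …, e_p` of a basis of `ℝⁿ`. -/
def initialSpan {n : ℕ} (e : Basis (Fin n) ℝ (Fin n → ℝ)) (p : ℕ) :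
    Submodule ℝ (Fin n → ℝ) :=
  Submodule.span ℝ (e '' {i : Fin n | (i : ℕ) < p})

theorem initialSpan_mono {n : ℕ} (e : Basis (Fin n) ℝ (Fin n → ℝ)) {p q : ℕ} (h : p ≤ q) :
    initialSpan e p ≤ initialSpan e q :=
  Submodule.span_mono (Set.image_mono fun _ hi => lt_of_lt_of_le hi h)

theorem initialSpan_zero {n : ℕ} (e : Basis (Fin n) ℝ (Fin n → ℝ)) : initialSpan e 0 = ⊥ := by
  simp [initialSpan]

theorem initialSpan_full {n : ℕ} (e : Basis (Fin n) ℝ (Fin n → ℝ)) : initialSpan e n = ⊤ := by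
  simp [initialSpan, e.span_eq]

theorem finrank_initialSpan {n : ℕ} (e : Basis (Fin n) ℝ (Fin n → ℝ)) {p : ℕ} (hp : p ≤ n) :
    finrank ℝ (initialSpan e p) = p := by
  classical
  have hset : e '' {i : Fin n | (i : ℕ) < p}
      = Set.range (fun j : Fin p => e (Fin.castLE hp j)) := by
    ext x
    constructor
    · rintro ⟨i, hi, rfl⟩
      exact ⟨⟨i, hi⟩, rfl⟩
    · rintro ⟨j, rfl⟩
      exact ⟨Fin.castLE hp j, j.2, rfl⟩
  have hli : LinearIndependent ℝ (fun j : Fin p => e (Fin.castLE hp j)) :=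
    e.linearIndependent.comp _ (Fin.castLE_injective hp)
  rw [initialSpan, hset, finrank_span_eq_card hli, Fintype.card_fin]

/-- The real partial flag space `Fl_I(ℝ)`: chains `0 = V₀ ⊂ V₁ ⊂ ⋯ ⊂ V_k = ℝⁿ` of subspaces
with `dim V_l = i₁ + ⋯ + i_l`. -/
structure PartialFlag {n : ℕ} (I : Composition n) where
  step : Fin (I.length + 1) → Submodule ℝ (Fin n → ℝ)
  step_zero : step 0 = ⊥
  step_last : step (Fin.last I.length) = ⊤
  mono : Monotone step
  finrank_step : ∀ l, finrank ℝ (step l) = I.sizeUpTo l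

namespace PartialFlag

variable {n : ℕ} {I : Composition n}

/-- The standard partial flag, spanned by initial segments of the standard basis of `ℝⁿ`. -/
noncomputable def standard (I : Composition n) : PartialFlag I where
  step l := initialSpan (Pi.basisFun ℝ (Fin n)) (I.sizeUpTo l)
  step_zero := by simp [initialSpan_zero]
  step_last := by simp [initialSpan_full]
  mono _ _ h := initialSpan_mono _ (I.monotone_sizeUpTo h)
  finrank_step l := finrank_initialSpan _ (I.sizeUpTo_le l)

/-- The image of a partial flag under a matrix `g ∈ SL(n, ℝ)`, acting on column vectors. -/
noncomputable def map (g : Matrix.SpecialLinearGroup (Fin n) ℝ) (E : PartialFlag I) : PartialFlag I where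
  step l := (E.step l).map (Matrix.SpecialLinearGroup.toLin' g).toLinearMap
  step_zero := by rw [E.step_zero, Submodule.map_bot]
  step_last := by rw [E.step_last, Submodule.map_top, LinearEquiv.range]
  mono _ _ h := Submodule.map_mono (E.mono h)
  finrank_step l := by rw [LinearEquiv.finrank_map_eq, E.finrank_step]

/-- The orbit map `SL(n, ℝ) → Fl_I(ℝ)` of the standard flag, which identifies `Fl_I(ℝ)` with the
quotient of `SL(n, ℝ)` by a parabolic subgroup. -/
noncomputable def ofSL (I : Composition n) (g : Matrix.SpecialLinearGroup (Fin n) ℝ) : PartialFlag I :=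
  map g (standard I)

/-- The usual topology of `Fl_I(ℝ) = SL(n, ℝ) / P`: the quotient topology. -/
noncomputable instance : TopologicalSpace (PartialFlag I) :=
  TopologicalSpace.coinduced (ofSL I) inferInstance

/-- The Schubert cell `X_ω ⊆ Fl_I(ℝ)` with respect to a basis `e₁, …, e_n` of `ℝⁿ`:
the flags `E` with `dim (E_q ∩ ⟨e₁, …, e_p⟩) = #{i ≤ p | ω(i) ≤ q}` for all
`1 ≤ p ≤ n`, `1 ≤ q ≤ k`.  The zero-based indices `p`, `q` below stand for `p + 1`, `q + 1`. -/
def schubertCell (e : Basis (Fin n) ℝ (Fin n → ℝ)) (ω : MultisetPerm I) :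
    Set (PartialFlag I) :=
  {E | ∀ (p : Fin n) (q : Fin I.length),
    finrank ℝ ↥(E.step q.succ ⊓ initialSpan e ((p : ℕ) + 1))
      = (Finset.univ.filter fun i : Fin n => i ≤ p ∧ ω.toFun i ≤ q).card}

/-- The Schubert variety: the closure of the Schubert cell in `Fl_I(ℝ)`. -/
def schubertVariety (e : Basis (Fin n) ℝ (Fin n → ℝ)) (ω : MultisetPerm I) :
    Set (PartialFlag I) :=
  closure (schubertCell e ω)

end PartialFlag

/-! Passing to complements, `ψ ≺ ω` says that `countLE`, the number prescribing `dim (E_q ∩ F_p)`,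
is everywhere at least as large for `ψ` as for `ω`. Necessity: `dim (E_q ∩ F_p)` is upper
semicontinuous (`isClosed_le_finrank_inf`), so a lower bound valid on `X_ω` persists on its closure;
a single flag of `X_ψ` there suffices. Sufficiency: if `ψ ≺ ω` and `ψ ≠ ω`, some swap of a
non-inverted pair of `ψ` stays below `ω` (`exists_swap_bruhatLE`). One swap is realised
geometrically: take a basis adapted to both `E ∈ X_ψ` and `F_•` (`mem_schubertCell_iff`) and replace
`v_i` by `v_i + t v_j`. For `t ≠ 0` the flag lies in the swapped cell, and it tends to `E` as `t →
0`. Iterating gives the inclusion. -/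

namespace MultisetPerm

/-! ### Combinatorics of the Bruhat order -/

variable {n : ℕ} {I : Composition n}

/-- The number of positions `i ≤ p` at which `τ` takes a value `≤ q`. -/
def countLE (τ : MultisetPerm I) (p : Fin n) (q : Fin I.length) : ℕ :=
  (Finset.univ.filter fun i : Fin n => i ≤ p ∧ τ.toFun i ≤ q).card

theorem rankNumber_add_card_lt (τ : MultisetPerm I) (p : Fin n) (q : Fin I.length) :
    τ.rankNumber p q + (Finset.univ.filter fun i : Fin n => i ≤ p ∧ τ.toFun i < q).card
      = (Finset.univ.filter fun i : Fin n => i ≤ p).card := by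
  rw [rankNumber, ← Finset.card_filter_add_card_filter_not (s := Finset.univ.filter (· ≤ p))
    (fun j => q ≤ τ.toFun j), Finset.filter_filter, Finset.filter_filter]
  simp only [not_le]

/-- The Bruhat order in terms of the numbers that define the Schubert cells. -/
theorem bruhatLE_iff_countLE {ψ ω : MultisetPerm I} :
    ψ.BruhatLE ω ↔ ∀ p q, ω.countLE p q ≤ ψ.countLE p q := by
  constructor
  · intro h p q
    -- The condition `≤ q` is the complement of `≥ q + 1`; for the last `q` it is vacuous.
    by_cases hq : (q : ℕ) + 1 < I.length
    · have key : ∀ τ : MultisetPerm I,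
          (Finset.univ.filter fun i : Fin n => i ≤ p ∧ τ.toFun i < ⟨q + 1, hq⟩).card
            = τ.countLE p q := fun τ => by
        simp only [countLE, Fin.lt_def, Fin.le_def, Nat.lt_succ_iff]
      have h1 := ψ.rankNumber_add_card_lt p ⟨q + 1, hq⟩
      have h2 := ω.rankNumber_add_card_lt p ⟨q + 1, hq⟩
      have h3 := h p ⟨q + 1, hq⟩
      rw [key] at h1 h2
      omega
    · refine Finset.card_le_card fun i hi => ?_
      simp only [Finset.mem_filter, Finset.mem_univ, true_and] at hi ⊢
      exact ⟨hi.1, by rw [Fin.le_def]; omega⟩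
  · intro h p q
    have h1 := ψ.rankNumber_add_card_lt p q
    have h2 := ω.rankNumber_add_card_lt p q
    suffices (Finset.univ.filter fun i : Fin n => i ≤ p ∧ ω.toFun i < q).card
        ≤ (Finset.univ.filter fun i : Fin n => i ≤ p ∧ ψ.toFun i < q).card by omega
    by_cases hq : (q : ℕ) = 0
    · refine Finset.card_le_card fun i hi => ?_
      simp only [Finset.mem_filter, Finset.mem_univ, true_and, Fin.lt_def] at hi
      omega
    · have key : ∀ τ : MultisetPerm I,
          (Finset.univ.filter fun i : Fin n => i ≤ p ∧ τ.toFun i < q).card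
            = τ.countLE p ⟨q - 1, by omega⟩ := fun τ => by
        simp only [countLE, Fin.lt_def, Fin.le_def]
        congr 1
        ext i
        simp only [Finset.mem_filter, Finset.mem_univ, true_and]
        omega
      rw [key, key]
      exact h _ _

/-- Precomposition of a multiset permutation with a permutation of the positions. -/
def permute (τ : MultisetPerm I) (σ : Equiv.Perm (Fin n)) : MultisetPerm I where
  toFun i := τ.toFun (σ i)
  surjective := τ.surjective.comp σ.surjective
  card_fiber j := by
    rw [← τ.card_fiber j]
    exact Finset.card_equiv σ (by simp)

theorem permute_toFun (τ : MultisetPerm I) (σ : Equiv.Perm (Fin n)) (i : Fin n) :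
    (τ.permute σ).toFun i = τ.toFun (σ i) := rfl

section Swap

variable {ψ ω : MultisetPerm I} {i j : Fin n}

theorem countLE_permute_swap_of_le (hij : i < j) {p : Fin n} (hp : j ≤ p) (q : Fin I.length) :
    (ψ.permute (Equiv.swap i j)).countLE p q = ψ.countLE p q := by
  refine Finset.card_equiv (Equiv.swap i j) fun l => ?_
  have : Equiv.swap i j l ≤ p ↔ l ≤ p := by
    by_cases h1 : l = i
    · subst h1; simp [hp, hij.le.trans hp]
    by_cases h2 : l = j
    · subst h2; simp [hp, hij.le.trans hp]
    rw [Equiv.swap_apply_of_ne_of_ne h1 h2]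
  simp only [Finset.mem_filter, Finset.mem_univ, true_and, this]
  rfl

theorem countLE_permute_swap_le (hij : i < j) (hψ : ψ.toFun i < ψ.toFun j) (p : Fin n)
    (q : Fin I.length) : (ψ.permute (Equiv.swap i j)).countLE p q ≤ ψ.countLE p q := by
  by_cases hp : j ≤ p
  · exact (countLE_permute_swap_of_le hij hp q).le
  refine Finset.card_le_card fun l hl => ?_
  simp only [Finset.mem_filter, Finset.mem_univ, true_and] at hl ⊢
  simp only [permute_toFun] at hl ⊢
  refine ⟨hl.1, ?_⟩
  by_cases h1 : l = i
  · subst h1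
    rw [Equiv.swap_apply_left] at hl
    exact hψ.le.trans hl.2
  · have h2 : l ≠ j := fun h => hp (h ▸ hl.1)
    rw [Equiv.swap_apply_of_ne_of_ne h1 h2] at hl
    exact hl.2

theorem countLE_permute_swap_lt (hij : i < j) (hψ : ψ.toFun i < ψ.toFun j) :
    (ψ.permute (Equiv.swap i j)).countLE i (ψ.toFun i) < ψ.countLE i (ψ.toFun i) := by
  refine Finset.card_lt_card (Finset.ssubset_iff_of_subset (fun l hl => ?_) |>.mpr ⟨i, ?_, ?_⟩)
  · simp only [Finset.mem_filter, Finset.mem_univ, true_and] at hl ⊢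
    simp only [permute_toFun] at hl ⊢
    refine ⟨hl.1, ?_⟩
    have h1 : l ≠ i := by
      rintro rfl
      rw [Equiv.swap_apply_left] at hl
      exact hψ.not_ge hl.2
    have h2 : l ≠ j := fun h => hij.not_ge (h ▸ hl.1)
    rw [Equiv.swap_apply_of_ne_of_ne h1 h2] at hl
    exact hl.2
  · simp
  · simp only [Finset.mem_filter, Finset.mem_univ, true_and]
    simpa [permute_toFun] using hψ

/-- A swap can lower the counts only in the rectangle `i ≤ p < j`, `ψ i ≤ q < ψ j`. -/
theorem countLE_le_permute_swap (hij : i < j) {p : Fin n} {q : Fin I.length}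
    (h : ¬ (i ≤ p ∧ p < j ∧ ψ.toFun i ≤ q ∧ q < ψ.toFun j)) :
    ψ.countLE p q ≤ (ψ.permute (Equiv.swap i j)).countLE p q := by
  by_cases hp : j ≤ p
  · exact (countLE_permute_swap_of_le hij hp q).ge
  refine Finset.card_le_card fun l hl => ?_
  simp only [Finset.mem_filter, Finset.mem_univ, true_and] at hl ⊢
  simp only [permute_toFun] at hl ⊢
  refine ⟨hl.1, ?_⟩
  by_cases h1 : l = i
  · subst h1
    rw [Equiv.swap_apply_left]
    by_contra hq
    exact h ⟨hl.1, not_le.mp hp, hl.2, not_le.mp hq⟩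
  · have h2 : l ≠ j := fun h => hp (h ▸ hl.1)
    rw [Equiv.swap_apply_of_ne_of_ne h1 h2]
    exact hl.2

/-- For `p < j`, only position `i` can drop out of the count. -/
theorem countLE_le_permute_swap_add_one (hij : i < j) (p : Fin n) (q : Fin I.length) :
    ψ.countLE p q ≤ (ψ.permute (Equiv.swap i j)).countLE p q + 1 := by
  by_cases hp : j ≤ p
  · exact (countLE_permute_swap_of_le hij hp q).ge.trans (Nat.le_succ _)
  rw [← Nat.sub_le_iff_le_add]
  refine le_trans (Finset.pred_card_le_card_erase (a := i)) (Finset.card_le_card fun l hl => ?_)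
  simp only [Finset.mem_erase, Finset.mem_filter, Finset.mem_univ, true_and] at hl ⊢
  simp only [permute_toFun] at hl ⊢
  refine ⟨hl.2.1, ?_⟩
  have h2 : l ≠ j := fun h => hp (h ▸ hl.2.1)
  rw [Equiv.swap_apply_of_ne_of_ne hl.1 h2]
  exact hl.2.2

end Swap

theorem countLE_eq_add (τ : MultisetPerm I) {i p : Fin n} (hip : i ≤ p) (q : Fin I.length) :
    τ.countLE p q = (Finset.univ.filter fun l : Fin n => l < i ∧ τ.toFun l ≤ q).card
      + (Finset.univ.filter fun l : Fin n => (i ≤ l ∧ l ≤ p) ∧ τ.toFun l ≤ q).card := by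
  rw [countLE, ← Finset.card_filter_add_card_filter_not (s := Finset.univ.filter _)
    (fun l => l < i), Finset.filter_filter, Finset.filter_filter]
  congr 2
  · ext l
    simp only [Finset.mem_filter, Finset.mem_univ, true_and]
    exact ⟨fun h => ⟨h.2, h.1.2⟩, fun h => ⟨⟨h.1.le.trans hip, h.2⟩, h.1⟩⟩
  · ext l
    simp only [Finset.mem_filter, Finset.mem_univ, true_and, not_lt]
    tauto

/-- If `ψ` lies strictly below `ω` in the Bruhat order, then some transposition of positions
that creates an inversion of `ψ` leads to an element that still lies below `ω`. -/
theorem exists_swap_bruhatLE {ψ ω : MultisetPerm I} (h : ψ.BruhatLE ω) (hne : ψ.toFun ≠ ω.toFun) :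
    ∃ i j, i < j ∧ ψ.toFun i < ψ.toFun j ∧ (ψ.permute (Equiv.swap i j)).BruhatLE ω := by
  rw [bruhatLE_iff_countLE] at h
  -- `i` is the first position where `ψ` and `ω` differ.
  obtain ⟨i, hi, hmin⟩ := WellFounded.has_min (wellFounded_lt (α := Fin n))
    {i | ψ.toFun i ≠ ω.toFun i} (Function.ne_iff.mp hne)
  have hagree : ∀ l < i, ψ.toFun l = ω.toFun l := fun l hl => by
    by_contra hc
    exact hmin l hc hl
  have hlt : ψ.toFun i < ω.toFun i := by
    refine lt_of_le_of_ne (not_lt.mp fun hc => ?_) hi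
    refine (h i (ω.toFun i)).not_gt (Finset.card_lt_card
      (Finset.ssubset_iff_of_subset (fun l hl => ?_) |>.mpr ⟨i, ?_, ?_⟩))
    · simp only [Finset.mem_filter, Finset.mem_univ, true_and] at hl ⊢
      refine ⟨hl.1, ?_⟩
      have : l ≠ i := by
        rintro rfl
        exact hc.not_ge hl.2
      rw [← hagree l (lt_of_le_of_ne hl.1 this)]
      exact hl.2
    · simp
    · simpa using hc
  -- Otherwise `ψ` never takes the value `ω i` from position `i` on, so its fibre over `ω i` is
  -- strictly inside that of `ω`.
  have hex : ∃ j, i < j ∧ ψ.toFun i < ψ.toFun j ∧ ψ.toFun j ≤ ω.toFun i := by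
    by_contra! hc
    have hcard := (ψ.card_fiber (ω.toFun i)).trans (ω.card_fiber (ω.toFun i)).symm
    refine hcard.not_lt (Finset.card_lt_card
      (Finset.ssubset_iff_of_subset (fun l hl => ?_) |>.mpr ⟨i, ?_, ?_⟩))
    · simp only [Finset.mem_filter, Finset.mem_univ, true_and] at hl ⊢
      rcases lt_trichotomy l i with hli | rfl | hli
      · rw [← hagree l hli, hl]
      · rfl
      · exact absurd (hc l hli (hl ▸ hlt)) (by rw [hl]; exact lt_irrefl _)
    · simp
    · simpa using hi
  -- The leftmost such `j`: between `i` and `j`, `ψ` takes no value in `(ψ i, ω i]`.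
  obtain ⟨j, ⟨hij, hψij, hjω⟩, hjmin⟩ := WellFounded.has_min (wellFounded_lt (α := Fin n))
    {j | i < j ∧ ψ.toFun i < ψ.toFun j ∧ ψ.toFun j ≤ ω.toFun i} hex
  refine ⟨i, j, hij, hψij, bruhatLE_iff_countLE.mpr fun p q => ?_⟩
  by_cases hpq : i ≤ p ∧ p < j ∧ ψ.toFun i ≤ q ∧ q < ψ.toFun j
  swap
  · exact (h p q).trans (countLE_le_permute_swap hij hpq)
  obtain ⟨hip, hpj, hiq, hqj⟩ := hpq
  -- The swap costs at most one, so a strict inequality for `ψ` is enough. It comes from comparing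
  -- `q` with `ω i`: on `[i, p]` the count of `ψ` is the same at both levels, while that of `ω`
  -- grows because of position `i`.
  refine Nat.lt_succ_iff.mp (lt_of_lt_of_le ?_ (countLE_le_permute_swap_add_one hij p q))
  have h0 := h p (ω.toFun i)
  rw [ψ.countLE_eq_add hip, ω.countLE_eq_add hip] at h0 ⊢
  have hpre : ∀ q, (Finset.univ.filter fun l : Fin n => l < i ∧ ψ.toFun l ≤ q)
      = Finset.univ.filter fun l : Fin n => l < i ∧ ω.toFun l ≤ q := fun q => by
    ext l
    simp only [Finset.mem_filter, Finset.mem_univ, true_and]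
    exact and_congr_right fun hl => by rw [hagree l hl]
  rw [hpre] at h0 ⊢
  have hψeq : (Finset.univ.filter fun l : Fin n => (i ≤ l ∧ l ≤ p) ∧ ψ.toFun l ≤ q)
      = Finset.univ.filter fun l : Fin n => (i ≤ l ∧ l ≤ p) ∧ ψ.toFun l ≤ ω.toFun i := by
    ext l
    simp only [Finset.mem_filter, Finset.mem_univ, true_and]
    refine and_congr_right fun hl => ⟨fun hlq => (hlq.trans hqj.le).trans hjω, fun hlω => ?_⟩
    refine le_trans (not_lt.mp fun hc => ?_) hiq
    have hil : i < l := lt_of_le_of_ne hl.1 (by rintro rfl; exact lt_irrefl _ hc)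
    exact hjmin l ⟨hil, hc, hlω⟩ (hl.2.trans_lt hpj)
  have hωlt : (Finset.univ.filter fun l : Fin n => (i ≤ l ∧ l ≤ p) ∧ ω.toFun l ≤ q).card
      < (Finset.univ.filter fun l : Fin n => (i ≤ l ∧ l ≤ p) ∧ ω.toFun l ≤ ω.toFun i).card := by
    refine Finset.card_lt_card
      (Finset.ssubset_iff_of_subset (fun l hl => ?_) |>.mpr ⟨i, ?_, ?_⟩)
    · simp only [Finset.mem_filter, Finset.mem_univ, true_and] at hl ⊢
      exact ⟨hl.1, (hl.2.trans hqj.le).trans hjω⟩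
    · simpa using hip
    · simpa using fun _ => hqj.trans_le hjω
  rw [hψeq]
  omega

/-- Every multiset permutation of type `I` is the block index function after a permutation. -/
theorem exists_perm_index (τ : MultisetPerm I) :
    ∃ σ : Equiv.Perm (Fin n), ∀ i, I.index (σ i) = τ.toFun i := by
  have hfib : ∀ j, Nonempty ({i // τ.toFun i = j} ≃ Fin (I.blocksFun j)) := fun j => by
    refine ⟨Fintype.equivFinOfCardEq ?_⟩
    rw [Fintype.card_subtype, τ.card_fiber]
  refine ⟨(Equiv.sigmaFiberEquiv τ.toFun).symm.trans
    ((Equiv.sigmaCongrRight fun j => (hfib j).some).trans I.blocksFinEquiv), fun i => ?_⟩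
  exact I.index_embedding _ _

/-- Identifies `I.index` as the pattern of the standard flag. -/
theorem succ_index_le_iff (i : Fin n) (l : Fin (I.length + 1)) :
    (I.index i).succ ≤ l ↔ (i : ℕ) < I.sizeUpTo l := by
  constructor
  · intro h
    exact (I.lt_sizeUpTo_index_succ i).trans_le (I.monotone_sizeUpTo h)
  · intro h
    by_contra! hc
    have hl : (l : ℕ) ≤ I.index i := Nat.lt_succ_iff.mp hc
    exact h.not_ge ((I.monotone_sizeUpTo hl).trans (I.sizeUpTo_index_le i))

theorem card_succ_le (τ : MultisetPerm I) (l : Fin (I.length + 1)) :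
    (Finset.univ.filter fun i : Fin n => (τ.toFun i).succ ≤ l).card = I.sizeUpTo l := by
  obtain ⟨σ, hσ⟩ := τ.exists_perm_index
  rw [Finset.card_equiv (t := Finset.univ.filter fun i : Fin n => (i : ℕ) < I.sizeUpTo l) σ
    fun i => by simp [← hσ, succ_index_le_iff]]
  rw [Fin.card_filter_val_lt, min_eq_right (I.sizeUpTo_le l)]

end MultisetPerm

/-! ### Bases compatible with the reference flag -/

section InitialSpan

variable {n : ℕ}

theorem finrank_span_basis_image (v : Basis (Fin n) ℝ (Fin n → ℝ)) (p : Fin n → Prop)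
    [DecidablePred p] :
    finrank ℝ (Submodule.span ℝ (v '' {i | p i})) = (Finset.univ.filter p).card := by
  have hli : LinearIndependent ℝ (fun i : {i // p i} => v i) :=
    v.linearIndependent.comp _ Subtype.val_injective
  have h := finrank_span_eq_card hli
  rw [Fintype.card_subtype] at h
  rw [← h]
  have hset : v '' {i | p i} = Set.range fun i : {i // p i} => v i := by
    ext x
    simp
  rw [hset]

theorem span_basis_image_inf (v : Basis (Fin n) ℝ (Fin n → ℝ)) (s t : Set (Fin n)) :
    Submodule.span ℝ (v '' s) ⊓ Submodule.span ℝ (v '' t) = Submodule.span ℝ (v '' (s ∩ t)) := by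
  ext x
  simp [Basis.mem_span_image]

/-- Vectors `v i`, each in the `(i + 1)`-st but not in the `i`-th step of the complete flag of
a basis `e`, have the same initial spans as `e`. -/
theorem span_image_eq_initialSpan {e : Basis (Fin n) ℝ (Fin n → ℝ)} {v : Fin n → Fin n → ℝ}
    (hv : ∀ i : Fin n, v i ∈ initialSpan e (i + 1)) (hv' : ∀ i : Fin n, v i ∉ initialSpan e i)
    {p : ℕ} (hp : p ≤ n) :
    Submodule.span ℝ (v '' {i | (i : ℕ) < p}) = initialSpan e p := by
  induction p with
  | zero => simp [initialSpan]
  | succ p ih =>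
    refine Submodule.eq_of_le_of_finrank_le (Submodule.span_le.mpr ?_) ?_
    · rintro _ ⟨i, hi, rfl⟩
      exact initialSpan_mono e hi (hv i)
    · rw [finrank_initialSpan e hp, Nat.succ_le_iff, ← finrank_initialSpan e (p := p) (by omega)]
      refine Submodule.finrank_lt_finrank_of_lt (SetLike.lt_iff_le_and_exists.mpr
        ⟨?_, v ⟨p, hp⟩, Submodule.subset_span ⟨⟨p, hp⟩, ?_, rfl⟩, hv' ⟨p, hp⟩⟩)
      swap
      · simp [finrank_initialSpan e (Nat.le_of_succ_le hp)]
      refine (ih (Nat.le_of_succ_le hp)).ge.trans (Submodule.span_mono (Set.image_mono fun i hi => ?_))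
      rw [finrank_initialSpan e (Nat.le_of_succ_le hp)]
      exact Nat.lt_succ_of_lt hi

theorem exists_basis_initialSpan_eq {e : Basis (Fin n) ℝ (Fin n → ℝ)} {v : Fin n → Fin n → ℝ}
    (hv : ∀ i : Fin n, v i ∈ initialSpan e (i + 1)) (hv' : ∀ i : Fin n, v i ∉ initialSpan e i) :
    ∃ b : Basis (Fin n) ℝ (Fin n → ℝ), ⇑b = v ∧
      ∀ p ≤ n, initialSpan b p = initialSpan e p := by
  have htop : ⊤ ≤ Submodule.span ℝ (Set.range v) := by
    have := span_image_eq_initialSpan hv hv' le_rfl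
    rw [initialSpan_full] at this
    rw [← this]
    exact Submodule.span_mono (Set.image_subset_range _ _)
  refine ⟨basisOfTopLeSpanOfCardEqFinrank v htop (by simp), by simp, fun p hp => ?_⟩
  rw [initialSpan, coe_basisOfTopLeSpanOfCardEqFinrank, span_image_eq_initialSpan hv hv' hp]

theorem basis_mem_initialSpan (e : Basis (Fin n) ℝ (Fin n → ℝ)) (i : Fin n) :
    e i ∈ initialSpan e (i + 1) :=
  Submodule.subset_span ⟨i, Nat.lt_succ_self _, rfl⟩

theorem basis_notMem_initialSpan (e : Basis (Fin n) ℝ (Fin n → ℝ)) (i : Fin n) :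
    e i ∉ initialSpan e i := by
  rw [initialSpan, Basis.mem_span_image]
  simp

end InitialSpan

/-! ### Adapted bases of flags in a Schubert cell -/

namespace PartialFlag

variable {n : ℕ} {I : Composition n}

theorem ext_step {E F : PartialFlag I} (h : ∀ l, E.step l = F.step l) : E = F := by
  cases E
  cases F
  congr
  exact funext h

theorem step_eq_span {E : PartialFlag I} {τ : MultisetPerm I}
    {v : Basis (Fin n) ℝ (Fin n → ℝ)} (hv : ∀ i, v i ∈ E.step (τ.toFun i).succ)
    (l : Fin (I.length + 1)) :
    E.step l = Submodule.span ℝ (v '' {i | (τ.toFun i).succ ≤ l}) := by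
  refine (Submodule.eq_of_le_of_finrank_eq (Submodule.span_le.mpr ?_) ?_).symm
  · rintro _ ⟨i, hi, rfl⟩
    exact E.mono hi (hv i)
  · rw [finrank_span_basis_image, τ.card_succ_le, E.finrank_step]

theorem finrank_inf_initialSpan_of_mem {e : Basis (Fin n) ℝ (Fin n → ℝ)} {τ : MultisetPerm I}
    {E : PartialFlag I} (hE : E ∈ schubertCell e τ) {p : ℕ} (hp : p ≤ n) (q : Fin I.length) :
    finrank ℝ ↥(E.step q.succ ⊓ initialSpan e p)
      = (Finset.univ.filter fun i : Fin n => (i : ℕ) < p ∧ τ.toFun i ≤ q).card := by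
  cases p with
  | zero => simp [initialSpan_zero]
  | succ p =>
    rw [hE ⟨p, hp⟩ q]
    simp only [Fin.le_def, Nat.lt_succ_iff]

/-- A flag lies in the Schubert cell of `τ` iff it is spanned, in the pattern given by `τ`,
by a basis with the same complete flag as `e`. -/
theorem mem_schubertCell_iff {e : Basis (Fin n) ℝ (Fin n → ℝ)} {τ : MultisetPerm I}
    {E : PartialFlag I} :
    E ∈ schubertCell e τ ↔ ∃ v : Fin n → Fin n → ℝ,
      (∀ i : Fin n, v i ∈ initialSpan e (i + 1)) ∧ (∀ i : Fin n, v i ∉ initialSpan e i) ∧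
        ∀ i, v i ∈ E.step (τ.toFun i).succ := by
  constructor
  · intro hE
    have key : ∀ i : Fin n, ∃ x, x ∈ initialSpan e (i + 1) ∧ x ∉ initialSpan e i ∧
        x ∈ E.step (τ.toFun i).succ := fun i => by
      -- Without such a vector the intersection would not grow from `F_i` to `F_{i+1}`, but position
      -- `i` itself raises the count.
      by_contra! hc
      have hle : E.step (τ.toFun i).succ ⊓ initialSpan e (i + 1)
          ≤ E.step (τ.toFun i).succ ⊓ initialSpan e i := fun x hx =>
        ⟨hx.1, by_contra fun hxi => hc x hx.2 hxi hx.1⟩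
      have := Submodule.finrank_mono hle
      rw [finrank_inf_initialSpan_of_mem hE i.2, finrank_inf_initialSpan_of_mem hE i.2.le] at this
      refine this.not_gt (Finset.card_lt_card
        (Finset.ssubset_iff_of_subset (fun l hl => ?_) |>.mpr ⟨i, ?_, ?_⟩))
      · simp only [Finset.mem_filter, Finset.mem_univ, true_and] at hl ⊢
        exact ⟨Nat.lt_succ_of_lt hl.1, hl.2⟩
      · simp
      · simp
    choose v h1 h2 h3 using key
    exact ⟨v, h1, h2, h3⟩
  · rintro ⟨v, h1, h2, h3⟩ p q
    obtain ⟨b, rfl, hb⟩ := exists_basis_initialSpan_eq h1 h2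
    rw [← hb _ p.2, step_eq_span h3, initialSpan, span_basis_image_inf]
    have : {i : Fin n | (τ.toFun i).succ ≤ q.succ} ∩ {i : Fin n | (i : ℕ) < p + 1}
        = {i : Fin n | i ≤ p ∧ τ.toFun i ≤ q} := by
      ext i
      simp only [Set.mem_inter_iff, Set.mem_ofPred_eq, Fin.succ_le_succ_iff,
        Nat.lt_succ_iff, Fin.val_fin_le]
      exact and_comm
    rw [this, finrank_span_basis_image]

/-- The flag spanned by the basis vectors `e i` in the pattern given by `τ`. -/
noncomputable def coordinate (e : Basis (Fin n) ℝ (Fin n → ℝ)) (τ : MultisetPerm I) :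
    PartialFlag I where
  step l := Submodule.span ℝ (e '' {i | (τ.toFun i).succ ≤ l})
  step_zero := by simp
  step_last := by simp [Fin.le_last, e.span_eq]
  mono _ _ h := Submodule.span_mono (Set.image_mono fun _ hi => le_trans hi h)
  finrank_step l := by rw [finrank_span_basis_image, τ.card_succ_le]

/-- Cells are nonempty, so an inclusion of `X_ψ` in a closure yields a common point. -/
theorem coordinate_mem_schubertCell (e : Basis (Fin n) ℝ (Fin n → ℝ)) (τ : MultisetPerm I) :
    coordinate e τ ∈ schubertCell e τ :=
  mem_schubertCell_iff.mpr ⟨e, basis_mem_initialSpan e, basis_notMem_initialSpan e,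
    fun i => Submodule.subset_span ⟨i, le_refl (τ.toFun i).succ, rfl⟩⟩

/-! ### The action of the special linear group -/

theorem continuous_ofSL : Continuous (ofSL I) := continuous_coinduced_rng

theorem map_mul (g h : Matrix.SpecialLinearGroup (Fin n) ℝ) (E : PartialFlag I) :
    map (g * h) E = map g (map h E) := ext_step fun l => by
  simp only [map]
  rw [← Submodule.map_comp, _root_.map_mul]
  rfl

theorem ofSL_mul (g h : Matrix.SpecialLinearGroup (Fin n) ℝ) :
    ofSL I (g * h) = map g (ofSL I h) :=
  map_mul _ _ _

/-- A flag spanned by a basis in some pattern is in the `SL(n, ℝ)`-orbit of the standard flag. -/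
theorem mem_range_ofSL {E : PartialFlag I} {τ : MultisetPerm I}
    {v : Basis (Fin n) ℝ (Fin n → ℝ)} (hv : ∀ i, v i ∈ E.step (τ.toFun i).succ) :
    ∃ g, ofSL I g = E := by
  obtain ⟨σ, hσ⟩ := τ.exists_perm_index
  obtain ⟨w, hw, hdet⟩ : ∃ w : Basis (Fin n) ℝ (Fin n → ℝ),
      (∀ i, w i ∈ E.step (I.index i).succ) ∧ (Pi.basisFun ℝ (Fin n)).det w = 1 := by
    set w := v.reindex σ with hw_def
    have hw : ∀ i, w i ∈ E.step (I.index i).succ := fun i => by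
      have := hv (σ.symm i)
      rw [← hσ, Equiv.apply_symm_apply] at this
      simpa [hw_def] using this
    rcases Nat.eq_zero_or_pos n with rfl | hn
    · exact ⟨w, hw, by simp⟩
    · have hd := (Pi.basisFun ℝ (Fin n)).isUnit_det w
      -- Rescaling one basis vector normalises the determinant without changing any span.
      let c : Fin n → ℝˣ := Function.update 1 ⟨0, hn⟩ hd.unit⁻¹
      refine ⟨w.unitsSMul c, fun i => ?_, ?_⟩
      · rw [Basis.unitsSMul_apply, Units.smul_def]
        exact Submodule.smul_mem _ _ (hw i)
      · have : ⇑(w.unitsSMul c) = fun i => (c i : ℝ) • w i := by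
          ext i : 1
          rw [Basis.unitsSMul_apply, Units.smul_def]
        rw [this, AlternatingMap.map_smul_univ, ← Units.coe_prod, Finset.prod_update_of_mem
          (Finset.mem_univ _)]
        simp only [Pi.one_apply, Finset.prod_const_one, mul_one, smul_eq_mul]
        exact hd.val_inv_mul
  rw [Basis.det_apply] at hdet
  let g : Matrix.SpecialLinearGroup (Fin n) ℝ := ⟨(Pi.basisFun ℝ (Fin n)).toMatrix w, hdet⟩
  refine ⟨g, ext_step fun l => ?_⟩
  refine Submodule.eq_of_le_of_finrank_eq ?_ (by rw [finrank_step, finrank_step])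
  change (initialSpan (Pi.basisFun ℝ (Fin n)) (I.sizeUpTo l)).map _ ≤ _
  rw [initialSpan, Submodule.map_span, Submodule.span_le]
  rintro _ ⟨_, ⟨i, hi, rfl⟩, rfl⟩
  have : Matrix.SpecialLinearGroup.toLin' g (Pi.basisFun ℝ (Fin n) i) = w i := by
    rw [Matrix.SpecialLinearGroup.toLin'_apply]
    ext k
    simp [g, Basis.toMatrix_apply]
  change _ ∈ E.step l
  rw [LinearEquiv.coe_coe, this]
  exact E.mono ((MultisetPerm.succ_index_le_iff i l).mpr hi) (hw i)

/-! ### Semicontinuity and necessity of the Bruhat order -/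

/-- The dimension of the intersection with a fixed subspace is upper semicontinuous on the
flag space. -/
theorem isClosed_le_finrank_inf (l : Fin (I.length + 1)) (F : Submodule ℝ (Fin n → ℝ)) (r : ℕ) :
    IsClosed {E : PartialFlag I | r ≤ finrank ℝ ↥(E.step l ⊓ F)} := by
  refine isClosed_coinduced.mpr ?_
  set S := (standard I).step l
  -- The map `(s, x) ↦ g s + x` has range `g S + F`, so its rank and `dim (g S ∩ F)` have constant
  -- sum; lower semicontinuity of rank gives the claim.
  let f : Matrix.SpecialLinearGroup (Fin n) ℝ → (S × F →L[ℝ] (Fin n → ℝ)) := fun g =>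
    LinearMap.toContinuousLinearMap
      (((Matrix.SpecialLinearGroup.toLin' g).toLinearMap ∘ₗ S.subtype).coprod F.subtype)
  have hf : Continuous f := by
    rw [continuous_clm_apply]
    intro y
    have : (fun g => f g y) = fun g : Matrix.SpecialLinearGroup (Fin n) ℝ =>
        (g : Matrix (Fin n) (Fin n) ℝ).mulVec y.1 + y.2 := by
      ext1 g
      simp [f, Matrix.SpecialLinearGroup.toLin'_apply]
    rw [this]
    exact (Continuous.matrix_mulVec continuous_subtype_val continuous_const).add continuous_const
  have hrank : ∀ g, finrank ℝ ↥((ofSL I g).step l ⊓ F)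
      + finrank ℝ (LinearMap.range (f g : S × F →ₗ[ℝ] (Fin n → ℝ)))
        = finrank ℝ S + finrank ℝ F := fun g => by
    have hr : LinearMap.range (f g : S × F →ₗ[ℝ] (Fin n → ℝ)) = (ofSL I g).step l ⊔ F := by
      simp only [f, LinearMap.coe_toContinuousLinearMap, LinearMap.range_coprod,
        LinearMap.range_comp, Submodule.range_subtype]
      rfl
    rw [hr, add_comm, Submodule.finrank_sup_add_finrank_inf_eq, finrank_step,
      (standard I).finrank_step]
  have hopen : IsOpen {g | finrank ℝ S + finrank ℝ F + 1
      ≤ r + finrank ℝ (LinearMap.range (f g : S × F →ₗ[ℝ] (Fin n → ℝ)))} := by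
    have := (isOpen_setOfPred_nat_le_rank (𝕜 := ℝ) (E := S × F) (F := Fin n → ℝ)
      (finrank ℝ S + finrank ℝ F + 1 - r)).preimage hf
    convert this using 1
    ext g
    simp only [Set.mem_ofPred_eq, Set.mem_preimage, LinearMap.rank, ← finrank_eq_rank,
      Nat.cast_le]
    omega
  convert hopen.isClosed_compl using 1
  ext g
  have := hrank g
  simp only [Set.mem_preimage, Set.mem_ofPred_eq, Set.mem_compl_iff]
  omega

theorem bruhatLE_of_mem_closure {e : Basis (Fin n) ℝ (Fin n → ℝ)} {ψ ω : MultisetPerm I}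
    {E : PartialFlag I} (hψ : E ∈ schubertCell e ψ) (hω : E ∈ closure (schubertCell e ω)) :
    ψ.BruhatLE ω := by
  refine MultisetPerm.bruhatLE_iff_countLE.mpr fun p q => ?_
  have := closure_minimal (fun E' (hE' : E' ∈ schubertCell e ω) => (hE' p q).ge)
    (isClosed_le_finrank_inf q.succ (initialSpan e (p + 1)) (ω.countLE p q)) hω
  exact le_trans this (hψ p q).le

/-! ### Degenerations along transvections -/

/-- The transvection `1 + φ ⊗ u` as an element of the special linear group. -/
noncomputable def transvectionSL (φ : Dual ℝ (Fin n → ℝ)) (u : Fin n → ℝ) (h : φ u = 0) :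
    Matrix.SpecialLinearGroup (Fin n) ℝ :=
  ⟨LinearMap.toMatrix' (LinearMap.transvection φ u), by
    rw [LinearMap.det_toMatrix', LinearMap.transvection.det, h, add_zero]⟩

theorem toLin'_transvectionSL (φ : Dual ℝ (Fin n → ℝ)) (u : Fin n → ℝ) (h : φ u = 0)
    (x : Fin n → ℝ) :
    Matrix.SpecialLinearGroup.toLin' (transvectionSL φ u h) x = x + φ x • u := by
  rw [Matrix.SpecialLinearGroup.toLin'_apply, transvectionSL, Matrix.toLin'_toMatrix',
    LinearMap.transvection.apply]

/-- Swapping the values of `ψ` at positions `i < j` that are not inverted gives a cell whose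
closure contains the cell of `ψ`. -/
theorem schubertCell_subset_closure_swap (e : Basis (Fin n) ℝ (Fin n → ℝ)) {ψ : MultisetPerm I}
    {i j : Fin n} (hij : i < j) (hψ : ψ.toFun i < ψ.toFun j) :
    schubertCell e ψ ⊆ closure (schubertCell e (ψ.permute (Equiv.swap i j))) := by
  intro E hE
  obtain ⟨v, h1, h2, h3⟩ := mem_schubertCell_iff.mp hE
  obtain ⟨b, rfl, -⟩ := exists_basis_initialSpan_eq h1 h2
  obtain ⟨h, rfl⟩ := mem_range_ofSL h3
  have hφ : ∀ t : ℝ, b.coord i (t • b j) = 0 := fun t => by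
    simp [hij.ne']
  let γ : ℝ → Matrix.SpecialLinearGroup (Fin n) ℝ := fun t =>
    transvectionSL (b.coord i) (t • b j) (hφ t)
  have hγ : Continuous γ := by
    refine Continuous.subtype_mk (continuous_matrix fun k l => ?_) _
    simp only [LinearMap.toMatrix'_apply, LinearMap.transvection.apply]
    fun_prop
  have hγ0 : γ 0 = 1 := by
    refine Matrix.SpecialLinearGroup.toLin'_injective (LinearEquiv.ext fun x => ?_)
    simp [γ, toLin'_transvectionSL]
  -- The punctured neighbourhood matters: `b i + t • b j` has leading position `j` only for `t ≠ 0`.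
  have hlim : Filter.Tendsto (fun t => ofSL I (γ t * h)) (nhdsWithin 0 {0}ᶜ)
      (nhds (ofSL I h)) := by
    have hc : Continuous fun t => ofSL I (γ t * h) :=
      continuous_ofSL.comp (hγ.mul continuous_const)
    have := hc.tendsto 0
    rw [hγ0, one_mul] at this
    exact this.mono_left nhdsWithin_le_nhds
  refine mem_closure_of_tendsto hlim ?_
  filter_upwards [self_mem_nhdsWithin] with t ht
  rw [ofSL_mul, mem_schubertCell_iff]
  have hmem : ∀ {x l}, x ∈ (ofSL I h).step l →
      x + b.coord i x • t • b j ∈ (map (γ t) (ofSL I h)).step l := fun {x l} hx =>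
    ⟨x, hx, toLin'_transvectionSL _ _ _ _⟩
  -- Position `j` now carries `b i + t • b j`, the image of `b i`, at level `ψ i`. Position `i`
  -- keeps `b i`, which lies in the moved flag only at level `ψ j`, as the difference of `b i + t •
  -- b j` and `t • b j`.
  refine ⟨Function.update b j (b i + t • b j), fun m => ?_, fun m => ?_, fun m => ?_⟩
  · by_cases hm : m = j
    · subst hm
      rw [Function.update_self]
      exact add_mem (initialSpan_mono e (by simpa using hij.le) (h1 i))
        (Submodule.smul_mem _ _ (h1 m))
    · rw [Function.update_of_ne hm]
      exact h1 m
  · by_cases hm : m = j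
    · subst hm
      rw [Function.update_self, Submodule.add_mem_iff_right _ (initialSpan_mono e hij (h1 i)),
        Submodule.smul_mem_iff _ ht]
      exact h2 m
    · rw [Function.update_of_ne hm]
      exact h2 m
  · rw [MultisetPerm.permute_toFun]
    by_cases hm : m = j
    · subst hm
      rw [Function.update_self, Equiv.swap_apply_right]
      simpa using hmem (h3 i)
    rw [Function.update_of_ne hm]
    by_cases hm' : m = i
    · subst hm'
      rw [Equiv.swap_apply_left]
      have hi := hmem ((ofSL I h).mono (Fin.succ_le_succ_iff.mpr hψ.le) (h3 m))
      have hj := Submodule.smul_mem _ t (hmem (h3 j))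
      have := sub_mem hi hj
      simpa [Finsupp.single_apply, hm, Ne.symm hm] using this
    · rw [Equiv.swap_apply_of_ne_of_ne hm' hm]
      simpa [Finsupp.single_apply, hm'] using hmem (h3 m)

theorem schubertCell_subset_closure_of_bruhatLE (e : Basis (Fin n) ℝ (Fin n → ℝ))
    {ψ ω : MultisetPerm I} (h : ψ.BruhatLE ω) :
    schubertCell e ψ ⊆ closure (schubertCell e ω) := by
  -- The sum of all counts strictly decreases with each swap.
  induction hN : ∑ p, ∑ q, ψ.countLE p q using Nat.strong_induction_on generalizing ψ with
  | _ N ih =>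
    by_cases hne : ψ.toFun = ω.toFun
    · have : ψ = ω := by
        cases ψ
        cases ω
        congr
      exact this ▸ subset_closure
    obtain ⟨i, j, hij, hψ, hle⟩ := MultisetPerm.exists_swap_bruhatLE h hne
    refine (schubertCell_subset_closure_swap e hij hψ).trans
      (closure_minimal (ih _ ?_ hle rfl) isClosed_closure)
    rw [← hN]
    have hmono := MultisetPerm.countLE_permute_swap_le hij hψ
    exact Finset.sum_lt_sum (fun p _ => Finset.sum_le_sum fun q _ => hmono p q)
      ⟨i, Finset.mem_univ _, Finset.sum_lt_sum (fun q _ => hmono i q)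
        ⟨ψ.toFun i, Finset.mem_univ _, MultisetPerm.countLE_permute_swap_lt hij hψ⟩⟩

end PartialFlag

/-- Adjacency of the cell `X_ψ` to the cell `X_ω` is stated both as `X_ψ ⊆ closure X_ω` and as
`X_ψ ∩ closure X_ω ≠ ∅`. -/
theorem mainTheorem5 {n : ℕ} (I : Composition n) (e : Module.Basis (Fin n) ℝ (Fin n → ℝ))
    (ψ ω : MultisetPerm I) :
    (ψ.BruhatLE ω ↔
      PartialFlag.schubertCell e ψ ⊆ closure (PartialFlag.schubertCell e ω)) ∧
    (ψ.BruhatLE ω ↔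
      (PartialFlag.schubertCell e ψ ∩ closure (PartialFlag.schubertCell e ω)).Nonempty) ∧
    (ψ.BruhatLE ω →
      PartialFlag.schubertVariety e ψ ⊆ PartialFlag.schubertVariety e ω) := by
  have hmem := PartialFlag.coordinate_mem_schubertCell e ψ
  have hsub := fun h : ψ.BruhatLE ω => PartialFlag.schubertCell_subset_closure_of_bruhatLE e h
  refine ⟨⟨hsub, fun h => PartialFlag.bruhatLE_of_mem_closure hmem (h hmem)⟩,
    ⟨fun h => ⟨_, hmem, hsub h hmem⟩, ?_⟩,
    fun h => closure_minimal (hsub h) isClosed_closure⟩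
  rintro ⟨E, hE, hE'⟩
  exact PartialFlag.bruhatLE_of_mem_closure hE hE'
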